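/- Conventions. Let $C_{l,Lip}(\mathbb R^n)$ be the set of $\varphi:\mathbb R^n\to\mathbb R$ with $|\varphi(x)-\varphi(y)|\le C(1+|x|^m+|y|^m)|x-y|$ for all $x,y$, for some $C>0$, $m\in\mathbb N$ depending on $\varphi$, and $C_{b,Lip}(\mathbb R^n)$ the set of bounded Lipschitz functions. A sublinear expectation space $(\Omega,\mathcal H,\hat E)$ consists of a set $\Omega$, a linear space $\mathcal H$ of real functions on $\Omega$ that contains the constants and is closed under $X\mapsto|X|$ and under $(X_1,\dots,X_n)\mapsto\varphi(X_1,\dots,X_n)$ for $\varphi\in C_{l,Lip}(\mathbb R^n)$, and a functional $\hat E:\mathcal H\to\mathbb R$ that is monotone, sub-additive, positively homogeneous and satisfies $\hat E[c]=c$ for constants $c$. An $\mathbb R^n$-valued random variable is an element of $\mathcal H^n$. $Y\in\mathcal H^n$ is independent from $X\in\mathcal H^m$ if $\hat E[\varphi(X,Y)]=\hat E\big[\hat E[\varphi(x,Y)]|_{x=X}\big]$ for all $\varphi\in C_{l,Lip}(\mathbb R^{m+n})$. For a bounded, closed, convex set $\Gamma\subset\mathbb R^d$, a $d$-dimensional random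 vector $\eta$ on a sublinear expectation space $(\Omega',\mathcal H',\hat E')$ is maximal distributed with set $\Gamma$, written $\eta\sim N(\Gamma;0)$, if $\hat E'[\varphi(\eta)]=\max_{y\in\Gamma}\varphi(y)$ for all $\varphi\in C_{b,Lip}(\mathbb R^d)$. Statement. Let $\{Y_i\}_{i=1}^\infty$ be a sequence of $\mathbb R^d$-valued random variables on a sublinear expectation space $(\Omega,\mathcal H,\hat E)$ such that (i) for each $i\ge1$, $Y_{i+1}$ is independent from $(Y_1,\dots,Y_i)$; (ii) there is a constant $M>0$ with $\hat E[|Y_i|^2]\le M$ for all $i\ge1$; (iv) the functions $g_i(p)=\hat E[\langle Y_i,p\rangle]$, $p\in\mathbb R^d$, converge pointwise to a function $g:\mathbb R^d\to\mathbb R$, i.e. $\lim_{i\to\infty}g_i(p)=g(p)$ for every $p\in\mathbb R^d$. Then there is a bounded, closed, convex set $\Gamma\subset\mathbb R^d$ with $g(p)=\sup_{q\in\Gamma}\langle p,q\rangle$ for all $p\in\mathbb R^d$. Moreover, for every such $\Gamma$, a random vector $\eta\sim N(\Gamma;0)$ exists on some sublinear expectation space, and, with $S_n=Y_1+\cdots+Y_n$,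 the sequence $S_n/n$ converges in law to $N(\Gamma;0)$: for every $\eta\sim N(\Gamma;0)$ on any sublinear expectation space $(\Omega',\mathcal H',\hat E')$, $$\lim_{n\to\infty}\hat E\Big[\varphi\Big(\frac{S_n}{n}\Big)\Big]=\hat E'[\varphi(\eta)]\qquad\text{for all }\varphi\in C_{b,Lip}(\mathbb R^d).$$ -/

import Mathlib

open Filter Topology

/-- The class `C_{l,Lip}` of locally Lipschitz functions of polynomial growth,
`|φ x - φ y| ≤ C (1 + ‖x‖ ^ m + ‖y‖ ^ m) ‖x - y‖`. On a finite-dimensional space the class does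
not depend on the choice of the norm (all norms being equivalent). -/
def IsCLLip {F : Type*} [NormedAddCommGroup F] (φ : F → ℝ) : Prop :=
  ∃ C : ℝ, 0 < C ∧ ∃ m : ℕ, ∀ x y : F, |φ x - φ y| ≤ C * (1 + ‖x‖ ^ m + ‖y‖ ^ m) * ‖x - y‖

/-- The class `C_{b,Lip}` of bounded Lipschitz functions. -/
def IsCBLip {F : Type*} [NormedAddCommGroup F] (φ : F → ℝ) : Prop :=
  (∃ K : NNReal, LipschitzWith K φ) ∧ ∃ C : ℝ, ∀ x, |φ x| ≤ C

/-- A sublinear expectation space `(Ω, H, E)`. The expectation is a functional on `H`; it is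
written as a total function on `Ω → ℝ`, about whose values outside `H` nothing is assumed. -/
structure SublinearExpectationSpace (Ω : Type*) where
  /-- the linear space of random variables -/
  H : Submodule ℝ (Ω → ℝ)
  const_mem : ∀ c : ℝ, (fun _ : Ω => c) ∈ H
  abs_mem : ∀ X ∈ H, (fun ω => |X ω|) ∈ H
  comp_mem : ∀ (n : ℕ) (X : Fin n → Ω → ℝ), (∀ i, X i ∈ H) →
    ∀ φ : EuclideanSpace ℝ (Fin n) → ℝ, IsCLLip φ →
      (fun ω => φ (WithLp.toLp 2 (fun i => X i ω))) ∈ H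
  /-- the sublinear expectation -/
  E : (Ω → ℝ) → ℝ
  mono : ∀ X ∈ H, ∀ Y ∈ H, (∀ ω, Y ω ≤ X ω) → E Y ≤ E X
  const : ∀ c : ℝ, E (fun _ => c) = c
  subadd : ∀ X ∈ H, ∀ Y ∈ H, E (fun ω => X ω + Y ω) ≤ E X + E Y
  pos_homog : ∀ X ∈ H, ∀ c : ℝ, 0 ≤ c → E (fun ω => c * X ω) = c * E X

namespace SublinearExpectationSpace

variable {Ω : Type*} (S : SublinearExpectationSpace Ω)

/-- `X` is a `d`-dimensional random vector: all its coordinates belong to `H`. -/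
def IsRandomVector {d : ℕ} (X : Ω → EuclideanSpace ℝ (Fin d)) : Prop :=
  ∀ j, (fun ω => X ω j) ∈ S.H

/-- `Y` is independent from `X`: `E[φ(X, Y)] = E[E[φ(x, Y)]|_{x = X}]` for all `φ` in
`C_{l,Lip}`. -/
def IndependentFrom {F G : Type*} [NormedAddCommGroup F] [NormedAddCommGroup G]
    (Y : Ω → G) (X : Ω → F) : Prop :=
  ∀ φ : F × G → ℝ, IsCLLip φ →
    S.E (fun ω => φ (X ω, Y ω)) = S.E (fun ω => S.E (fun ω' => φ (X ω, Y ω')))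

/-- `η ∼ N(Γ; 0)`: the random vector `η` is maximal distributed with set `Γ`, that is,
`E[φ(η)] = max_{y ∈ Γ} φ y` for all `φ` in `C_{b,Lip}`. (The maximum is attained, so `Γ` is
nonempty.) -/
def IsMaximalDistributed {d : ℕ} (η : Ω → EuclideanSpace ℝ (Fin d))
    (Γ : Set (EuclideanSpace ℝ (Fin d))) : Prop :=
  S.IsRandomVector η ∧ Bornology.IsBounded Γ ∧ IsClosed Γ ∧ Convex ℝ Γ ∧
    ∀ φ : EuclideanSpace ℝ (Fin d) → ℝ, IsCBLip φ → IsGreatest (φ '' Γ) (S.E (fun ω => φ (η ω)))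

end SublinearExpectationSpace

/-- `Γ` is a bounded, closed, convex set that represents `g`, i.e.
`g p = sup_{q ∈ Γ} ⟨p, q⟩` for all `p`. (A least upper bound in `ℝ` forces `Γ` to be nonempty.) -/
def Represents {d : ℕ} (Γ : Set (EuclideanSpace ℝ (Fin d)))
    (g : EuclideanSpace ℝ (Fin d) → ℝ) : Prop :=
  Bornology.IsBounded Γ ∧ IsClosed Γ ∧ Convex ℝ Γ ∧
    ∀ p, IsLUB ((fun q => inner ℝ p q) '' Γ) (g p)

/-! The proof is a second-moment argument that handles the two inequalities separately; no PDE is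
used. Upper bound: let `h n x` be the distance from `x` to `n Γ`, and `a` the vector to `x` from a
nearest point of `n Γ`. If `q ∈ Γ` maximizes `⟨a, ·⟩`, so that `⟨a, q⟩ = g a`, then `h (n+1) (x +
Y)² ≤ ‖a + Y - q‖²`. The expectation of the right side is at most `‖a‖² + 2 (g_n a - g a) + const`.
Lower bound: fix `q ∈ Γ` and run the same expansion on `-‖S_n - n q‖²`, where `⟨p, q⟩ ≤ g p`
controls the cross term. The second moments make the `g_n` equi-Lipschitz, so `g_n → g` uniformly on
the unit ball (`eventually_abs_sub_le_mul_norm`) and the cross term costs at most `ε ‖a‖`. Since `E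
‖S_n‖ = O(n)`, conditioning (`E_sum_succ`) gives increments `ε n + C`, hence `o(n²)` in both cases
(`eventually_E_sq_le`, `eventually_le_E_neg_sq`). Dividing by `n²`, the means approach `Γ` in mean
square, while each point of `Γ` is approached in lower expectation. A Lipschitz `φ` turns these
facts into the upper and lower bounds by its maximum on `Γ`. The set `Γ` comes from Hahn–Banach
(`exists_represents`). -/

namespace IsCLLip

/-! ### Closure properties of the class `C_{l,Lip}`. -/

variable {F G : Type*} [NormedAddCommGroup F] [NormedAddCommGroup G]

theorem neg {f : F → ℝ} (hf : IsCLLip f) : IsCLLip (fun x => -f x) := by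
  obtain ⟨C, hC, m, h⟩ := hf
  refine ⟨C, hC, m, fun x y => ?_⟩
  rw [neg_sub_neg, abs_sub_comm]
  exact h x y

theorem comp_lipschitz {f : G → ℝ} (hf : IsCLLip f) {T : F → G} {K : ℝ} (hK : 1 ≤ K)
    (hT : ∀ x y, ‖T x - T y‖ ≤ K * ‖x - y‖) (hT0 : ∀ x, ‖T x‖ ≤ K * ‖x‖) :
    IsCLLip (fun x => f (T x)) := by
  obtain ⟨C, hC, m, h⟩ := hf
  refine ⟨C * K ^ m * K, by positivity, m, fun x y => (h _ _).trans ?_⟩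
  have hKm : 1 ≤ K ^ m := one_le_pow₀ hK
  have h1 : ∀ z, ‖T z‖ ^ m ≤ K ^ m * ‖z‖ ^ m := fun z => by
    rw [← mul_pow]; exact pow_le_pow_left₀ (norm_nonneg _) (hT0 z) m
  calc C * (1 + ‖T x‖ ^ m + ‖T y‖ ^ m) * ‖T x - T y‖
      ≤ C * (K ^ m + K ^ m * ‖x‖ ^ m + K ^ m * ‖y‖ ^ m) * (K * ‖x - y‖) := by
        gcongr
        · exact h1 x
        · exact h1 y
        · exact hT x y
    _ = _ := by ring

/-- Lipschitz functions belong to `C_{l,Lip}`. -/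
theorem of_lipschitz {f : F → ℝ} {K : ℝ} (hf : ∀ x y, |f x - f y| ≤ K * ‖x - y‖) :
    IsCLLip f := by
  refine ⟨|K| + 1, by positivity, 0, fun x y => (hf x y).trans ?_⟩
  have := le_abs_self K
  have := abs_nonneg K
  gcongr
  simp only [pow_zero]
  linarith

/-- The square of a nonnegative 1-Lipschitz function belongs to `C_{l,Lip}`. -/
theorem sq_of_lipschitz {h : F → ℝ} (h0 : ∀ x, 0 ≤ h x) (hh : ∀ x y, |h x - h y| ≤ ‖x - y‖) :
    IsCLLip (fun x => h x ^ 2) := by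
  refine ⟨2 * h 0 + 1, by linarith [h0 0], 1, fun x y => ?_⟩
  have hx : h x ≤ h 0 + ‖x‖ := by
    have := (le_abs_self _).trans (hh x 0); rw [sub_zero] at this; linarith
  have hy : h y ≤ h 0 + ‖y‖ := by
    have := (le_abs_self _).trans (hh y 0); rw [sub_zero] at this; linarith
  have e : h x ^ 2 - h y ^ 2 = (h x + h y) * (h x - h y) := by ring
  rw [e, abs_mul, abs_of_nonneg (add_nonneg (h0 x) (h0 y)), pow_one, pow_one]
  have h00 := h0 0
  have hn := norm_nonneg x
  have hn' := norm_nonneg y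
  have hb : h x + h y ≤ (2 * h 0 + 1) * (1 + ‖x‖ + ‖y‖) := by nlinarith
  exact mul_le_mul hb (hh x y) (abs_nonneg _) (by positivity)

theorem _root_.IsCBLip.isCLLip {f : F → ℝ} (hf : IsCBLip f) : IsCLLip f := by
  obtain ⟨⟨K, hK⟩, -⟩ := hf
  refine of_lipschitz (K := K) fun x y => ?_
  have := hK.dist_le_mul x y
  rwa [Real.dist_eq, dist_eq_norm] at this

end IsCLLip

/-! ### Calculus of sublinear expectations and conditioning. -/

namespace SublinearExpectationSpace

variable {Ω : Type*} (S : SublinearExpectationSpace Ω)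

theorem add_mem {X Z : Ω → ℝ} (hX : X ∈ S.H) (hZ : Z ∈ S.H) : (fun ω => X ω + Z ω) ∈ S.H :=
  S.H.add_mem hX hZ

theorem smul_mem {X : Ω → ℝ} (hX : X ∈ S.H) (c : ℝ) : (fun ω => c * X ω) ∈ S.H :=
  S.H.smul_mem c hX

theorem neg_mem {X : Ω → ℝ} (hX : X ∈ S.H) : (fun ω => -X ω) ∈ S.H :=
  S.H.neg_mem hX

theorem sub_mem {X Z : Ω → ℝ} (hX : X ∈ S.H) (hZ : Z ∈ S.H) : (fun ω => X ω - Z ω) ∈ S.H :=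
  S.H.sub_mem hX hZ

theorem E_add_const_le {X : Ω → ℝ} (hX : X ∈ S.H) (c : ℝ) :
    S.E (fun ω => X ω + c) ≤ S.E X + c := by
  have h := S.subadd X hX _ (S.const_mem c)
  rwa [S.const] at h

theorem le_E_add_const {X : Ω → ℝ} (hX : X ∈ S.H) (c : ℝ) :
    S.E X + c ≤ S.E (fun ω => X ω + c) := by
  have h := S.E_add_const_le (S.add_mem hX (S.const_mem c)) (-c)
  simp only [add_neg_cancel_right] at h
  linarith

theorem E_sub_E_le {X Z : Ω → ℝ} (hX : X ∈ S.H) (hZ : Z ∈ S.H) :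
    S.E X - S.E Z ≤ S.E (fun ω => X ω - Z ω) := by
  have h := S.subadd _ (S.add_mem hX (S.neg_mem hZ)) Z hZ
  simp only [neg_add_cancel_right] at h
  simp only [sub_eq_add_neg] at *
  linarith

/-- The expectation of a difference is bounded by that of any upper bound of the absolute
difference. -/
theorem abs_E_sub_E_le {X Z W : Ω → ℝ} (hX : X ∈ S.H) (hZ : Z ∈ S.H) (hW : W ∈ S.H)
    (h : ∀ ω, |X ω - Z ω| ≤ W ω) : |S.E X - S.E Z| ≤ S.E W := by
  rw [abs_le]
  have h1 := S.E_sub_E_le hX hZ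
  have h2 := S.E_sub_E_le hZ hX
  have h3 : S.E (fun ω => X ω - Z ω) ≤ S.E W :=
    S.mono _ hW _ (S.sub_mem hX hZ) fun ω => (abs_le.1 (h ω)).2
  have h4 : S.E (fun ω => Z ω - X ω) ≤ S.E W :=
    S.mono _ hW _ (S.sub_mem hZ hX) fun ω => by linarith [(abs_le.1 (h ω)).1]
  constructor <;> linarith

variable {d : ℕ}

variable {S} in
theorem IsRandomVector.comp_mem {X : Ω → EuclideanSpace ℝ (Fin d)} (hX : S.IsRandomVector X)
    {f : EuclideanSpace ℝ (Fin d) → ℝ} (hf : IsCLLip f) : (fun ω => f (X ω)) ∈ S.H :=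
  S.comp_mem d (fun j ω => X ω j) hX f hf

variable {S} in
theorem IsRandomVector.add {X Z : Ω → EuclideanSpace ℝ (Fin d)} (hX : S.IsRandomVector X)
    (hZ : S.IsRandomVector Z) : S.IsRandomVector (fun ω => X ω + Z ω) :=
  fun j => S.add_mem (hX j) (hZ j)

theorem isRandomVector_const (x : EuclideanSpace ℝ (Fin d)) :
    S.IsRandomVector (fun _ => x) := fun j => S.const_mem (x j)

variable {S} in
theorem IsRandomVector.sum {Y : ℕ → Ω → EuclideanSpace ℝ (Fin d)}
    (hY : ∀ i, S.IsRandomVector (Y i)) (n : ℕ) :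
    S.IsRandomVector (fun ω => ∑ i ∈ Finset.range n, Y i ω) := by
  induction n with
  | zero => simpa using S.isRandomVector_const (0 : EuclideanSpace ℝ (Fin d))
  | succ n ih => simpa only [Finset.sum_range_succ] using ih.add (hY n)

theorem isCLLip_norm_pow {F : Type*} [NormedAddCommGroup F] (m : ℕ) :
    IsCLLip (fun x : F => ‖x‖ ^ m) := by
  -- `m + 1` instead of `m` keeps the constant positive when `m = 0`, where `m - 1` truncates to
  -- `0`.
  refine ⟨m + 1, by positivity, m - 1, fun x y => ?_⟩
  have key : |‖x‖ ^ m - ‖y‖ ^ m| ≤ |‖x‖ - ‖y‖| * m * max |‖x‖| |‖y‖| ^ (m - 1) :=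
    abs_pow_sub_pow_le ..
  rw [abs_norm, abs_norm] at key
  refine key.trans ?_
  have hmax : max ‖x‖ ‖y‖ ^ (m - 1) ≤ 1 + ‖x‖ ^ (m - 1) + ‖y‖ ^ (m - 1) := by
    have h1 : 0 ≤ ‖x‖ ^ (m - 1) := by positivity
    have h2 : 0 ≤ ‖y‖ ^ (m - 1) := by positivity
    rcases max_choice ‖x‖ ‖y‖ with h | h <;> rw [h] <;> linarith
  calc |‖x‖ - ‖y‖| * m * max ‖x‖ ‖y‖ ^ (m - 1)
      ≤ ‖x - y‖ * (m + 1) * (1 + ‖x‖ ^ (m - 1) + ‖y‖ ^ (m - 1)) := by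
        gcongr
        · exact abs_norm_sub_norm_le x y
        · linarith
    _ = _ := by ring

variable {S} in
-- Puts the inner expectation in an iterated expectation back into `H` once a random vector is
-- substituted for `x`; monotonicity is available only on `H`. The growth exponent is unchanged
-- because `E ‖X‖ ^ m` is a finite constant.
theorem IsRandomVector.isCLLip_E {X : Ω → EuclideanSpace ℝ (Fin d)} (hX : S.IsRandomVector X)
    {f : EuclideanSpace ℝ (Fin d) → ℝ} (hf : IsCLLip f) :
    IsCLLip (fun x => S.E (fun ω => f (x + X ω))) := by
  have hmem : ∀ x, (fun ω => f (x + X ω)) ∈ S.H := fun x =>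
    ((S.isRandomVector_const x).add hX).comp_mem hf
  obtain ⟨C, hC, m, h⟩ := hf
  have hN : (fun ω => ‖X ω‖ ^ m) ∈ S.H := hX.comp_mem (isCLLip_norm_pow m)
  set A := S.E (fun ω => ‖X ω‖ ^ m)
  have hA : 0 ≤ A := by
    have := S.mono _ hN _ (S.const_mem 0) fun ω => by positivity
    rwa [S.const] at this
  have h2 : (1 : ℝ) ≤ 2 ^ m := one_le_pow₀ (by norm_num)
  refine ⟨C * (2 ^ m * (2 * A + 1)), by positivity, m, fun x y => ?_⟩
  have hpow : ∀ a b : EuclideanSpace ℝ (Fin d), ‖a + b‖ ^ m ≤ 2 ^ m * (‖a‖ ^ m + ‖b‖ ^ m) := by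
    intro a b
    calc ‖a + b‖ ^ m ≤ (‖a‖ + ‖b‖) ^ m := by gcongr; exact norm_add_le _ _
      _ ≤ 2 ^ (m - 1) * (‖a‖ ^ m + ‖b‖ ^ m) := add_pow_le (norm_nonneg _) (norm_nonneg _) m
      _ ≤ _ := by gcongr; norm_num; omega
  set B := C * ‖x - y‖ * 2 ^ m
  have hW := S.add_mem (S.smul_mem hN (2 * B))
    (S.const_mem (B * (1 + ‖x‖ ^ m + ‖y‖ ^ m)))
  refine (S.abs_E_sub_E_le (hmem x) (hmem y) hW fun ω => ?_).trans ?_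
  · refine (h _ _).trans ?_
    rw [add_sub_add_right_eq_sub]
    calc C * (1 + ‖x + X ω‖ ^ m + ‖y + X ω‖ ^ m) * ‖x - y‖
        ≤ C * (2 ^ m + 2 ^ m * (‖x‖ ^ m + ‖X ω‖ ^ m) + 2 ^ m * (‖y‖ ^ m + ‖X ω‖ ^ m))
            * ‖x - y‖ := by
          gcongr <;> exact hpow _ _
      _ = _ := by ring
  · refine (S.E_add_const_le (S.smul_mem hN _) _).trans ?_
    rw [S.pos_homog _ hN _ (by positivity)]
    change 2 * B * A + _ ≤ _
    have hp : 0 ≤ ‖x‖ ^ m + ‖y‖ ^ m := by positivity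
    have hB : 0 ≤ B := by positivity
    have : 2 * B * A + B * (1 + ‖x‖ ^ m + ‖y‖ ^ m)
        ≤ B * ((2 * A + 1) * (1 + ‖x‖ ^ m + ‖y‖ ^ m)) := by
      nlinarith [mul_nonneg hB (mul_nonneg hA hp)]
    refine this.trans (le_of_eq ?_)
    ring

/-- Conditioning on the first partial sum. -/
theorem E_sum_succ {Y : ℕ → Ω → EuclideanSpace ℝ (Fin d)}
    (hindep : ∀ i : ℕ, S.IndependentFrom (Y (i + 1))
      (fun ω => fun k : Fin (i + 1) => Y (k : ℕ) ω))
    {f : EuclideanSpace ℝ (Fin d) → ℝ} (hf : IsCLLip f) {n : ℕ} (hn : 1 ≤ n) :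
    S.E (fun ω => f (∑ i ∈ Finset.range (n + 1), Y i ω)) =
      S.E (fun ω => S.E (fun ω' => f ((∑ i ∈ Finset.range n, Y i ω) + Y n ω'))) := by
  obtain ⟨k, rfl⟩ : ∃ k, n = k + 1 := ⟨n - 1, by omega⟩
  -- Independence is applied to `f ∘ T` with `T` the summation map. In the sup norm on the product
  -- each of the `k + 2` summands is at most `‖z‖`.
  let T : (Fin (k + 1) → EuclideanSpace ℝ (Fin d)) × EuclideanSpace ℝ (Fin d) →
      EuclideanSpace ℝ (Fin d) := fun z => (∑ i, z.1 i) + z.2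
  have hT : ∀ z, ‖T z‖ ≤ (k + 2 : ℝ) * ‖z‖ := by
    intro z
    have h1 : ‖∑ i, z.1 i‖ ≤ ∑ _i : Fin (k + 1), ‖z‖ :=
      norm_sum_le_of_le _ fun i _ => (norm_le_pi_norm z.1 i).trans (norm_fst_le z)
    have h2 := norm_snd_le z
    have h3 := norm_add_le (∑ i, z.1 i) z.2
    simp at h1
    change ‖(∑ i, z.1 i) + z.2‖ ≤ _
    linarith
  have hTsub : ∀ x y, ‖T x - T y‖ ≤ (k + 2 : ℝ) * ‖x - y‖ := by
    intro x y
    have : T x - T y = T (x - y) := by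
      simp only [T, Prod.fst_sub, Prod.snd_sub, Pi.sub_apply, Finset.sum_sub_distrib]
      abel
    rw [this]
    exact hT _
  have h := hindep k _ (hf.comp_lipschitz (by have : (0:ℝ) ≤ k := k.cast_nonneg; linarith) hTsub hT)
  simpa only [T, Finset.sum_range_succ _ (k + 1), Finset.sum_range] using h

end SublinearExpectationSpace

/-! ### Growth of sequences, uniform convergence, support functions. -/

/-- A sequence whose increments are at most `ε n + C` for every `ε > 0` eventually is `o(n ^ 2)`
from above. -/
theorem eventually_le_mul_sq_of_increments {a : ℕ → ℝ} {C : ℝ}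
    (h : ∀ ε > 0, ∀ᶠ n in atTop, a (n + 1) ≤ a n + ε * n + C) {ε : ℝ} (hε : 0 < ε) :
    ∀ᶠ n : ℕ in atTop, a n ≤ ε * (n : ℝ) ^ 2 := by
  have hlim : Tendsto (fun n : ℕ => ε / 4 * (n : ℝ)) atTop atTop :=
    tendsto_natCast_atTop_atTop.const_mul_atTop (by positivity)
  -- Past `N` each increment is at most `ε / 4 * n + C ≤ ε / 2 * n`, less than that of `ε / 2 * n ^
  -- 2`; the other half of `ε` later absorbs `a N`.
  obtain ⟨N, hN⟩ := eventually_atTop.1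
    ((h (ε / 4) (by positivity)).and (hlim.eventually_ge_atTop C))
  have hind : ∀ n ≥ N, a n ≤ a N + ε / 2 * (n : ℝ) ^ 2 := by
    intro n hn
    induction n, hn using Nat.le_induction with
    | base => have : 0 ≤ ε / 2 * (N : ℝ) ^ 2 := by positivity
              linarith
    | succ n hn ih =>
      obtain ⟨h1, h2⟩ := hN n hn
      have h3 : (0 : ℝ) ≤ n := n.cast_nonneg
      push_cast
      nlinarith [mul_nonneg hε.le h3]
  have hlim' : Tendsto (fun n : ℕ => ε / 2 * (n : ℝ) ^ 2) atTop atTop :=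
    ((tendsto_pow_atTop two_ne_zero).comp tendsto_natCast_atTop_atTop).const_mul_atTop
      (by positivity)
  filter_upwards [hlim'.eventually_ge_atTop (a N), eventually_ge_atTop N] with n h1 h2
  linarith [hind n h2]

/-- Pointwise convergence of equi-Lipschitz positively homogeneous functions on a
finite-dimensional space is uniform on the unit ball. -/
theorem eventually_abs_sub_le_mul_norm {V : Type*} [NormedAddCommGroup V] [NormedSpace ℝ V]
    [FiniteDimensional ℝ V] {G : ℕ → V → ℝ} {g : V → ℝ} {K : ℝ} (hK : 0 ≤ K)
    (hG : ∀ i p q, |G i p - G i q| ≤ K * ‖p - q‖)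
    (hhom : ∀ i p (c : ℝ), 0 ≤ c → G i (c • p) = c * G i p)
    (hlim : ∀ p, Tendsto (fun i => G i p) atTop (𝓝 (g p))) {ε : ℝ} (hε : 0 < ε) :
    ∀ᶠ i in atTop, ∀ p, |G i p - g p| ≤ ε * ‖p‖ := by
  have := FiniteDimensional.proper ℝ V
  have hg : ∀ p q, |g p - g q| ≤ K * ‖p - q‖ := fun p q =>
    le_of_tendsto ((hlim p).sub (hlim q)).abs (Eventually.of_forall fun i => hG i p q)
  have hghom : ∀ p (c : ℝ), 0 ≤ c → g (c • p) = c * g p := fun p c hc =>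
    tendsto_nhds_unique (hlim (c • p))
      (((hlim p).const_mul c).congr fun i => (hhom i p c hc).symm)
  -- Mesh of the net: moving to a net point costs `ε / 3` for `G i` and for `g`, leaving `ε / 3` for
  -- convergence on the net. `K + 1` avoids division by zero.
  have hδ : 0 < ε / (3 * (K + 1)) := by positivity
  obtain ⟨t, -, htfin, htcov⟩ := (isCompact_closedBall (0 : V) 1).finite_cover_balls hδ
  have hev : ∀ᶠ i in atTop, ∀ q ∈ t, |G i q - g q| < ε / 3 :=
    (eventually_all_finite htfin).2 fun q _ => by
      simpa only [Real.dist_eq] using (Metric.tendsto_nhds.1 (hlim q)) (ε / 3) (by positivity)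
  filter_upwards [hev] with i hi p
  have hunit : ∀ u : V, ‖u‖ ≤ 1 → |G i u - g u| ≤ ε := by
    intro u hu
    obtain ⟨q, hq, huq⟩ := Set.mem_iUnion₂.1 (htcov (mem_closedBall_zero_iff.2 hu))
    rw [mem_ball_iff_norm] at huq
    have hKd : K * ‖u - q‖ ≤ ε / 3 := by
      calc K * ‖u - q‖ ≤ (K + 1) * (ε / (3 * (K + 1))) := by gcongr; linarith
        _ = ε / 3 := by field_simp
    have h1 := abs_le.1 (hG i u q)
    have h2 := abs_le.1 (hg u q)
    have h3 := abs_lt.1 (hi q hq)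
    rw [abs_le]
    constructor <;> linarith [h1.1, h1.2, h2.1, h2.2, h3.1, h3.2]
  have hp : p = ‖p‖ • (‖p‖⁻¹ • p) := by
    rcases eq_or_ne p 0 with rfl | h
    · simp
    · rw [smul_inv_smul₀ (norm_ne_zero_iff.2 h)]
  have hu : ‖‖p‖⁻¹ • p‖ ≤ 1 := by
    rw [norm_smul, norm_inv, norm_norm]
    exact inv_mul_le_one
  rw [hp, hhom i _ _ (norm_nonneg p), hghom _ _ (norm_nonneg p), ← mul_sub, abs_mul, abs_norm,
    ← hp, mul_comm]
  exact mul_le_mul_of_nonneg_right (hunit _ hu) (norm_nonneg p)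

/-- A sublinear function bounded by a multiple of the norm is a support function. -/
theorem exists_represents {d : ℕ} {g : EuclideanSpace ℝ (Fin d) → ℝ} {K : ℝ}
    (hK : ∀ p, g p ≤ K * ‖p‖) (hadd : ∀ p q, g (p + q) ≤ g p + g q)
    (hhom : ∀ p (c : ℝ), 0 ≤ c → g (c • p) = c * g p) :
    ∃ Γ : Set (EuclideanSpace ℝ (Fin d)), Represents Γ g := by
  have g0 : g 0 = 0 := by simpa using hhom 0 0 le_rfl
  have hneg : ∀ p, 0 ≤ g p + g (-p) := fun p => by
    have := hadd p (-p); rwa [add_neg_cancel, g0] at this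
  refine ⟨{q | ∀ p, inner ℝ p q ≤ g p}, ?_, ?_, ?_, fun p => ?_⟩
  · refine (Metric.isBounded_closedBall (x := 0) (r := |K|)).subset fun q hq => ?_
    rw [mem_closedBall_zero_iff]
    have h1 := (hq q).trans (hK q)
    rw [real_inner_self_eq_norm_mul_norm] at h1
    rcases (norm_nonneg q).eq_or_lt with h | h
    · rw [← h]; exact abs_nonneg K
    · exact (le_of_mul_le_mul_right h1 h).trans (le_abs_self K)
  · rw [Set.ofPred_forall]
    exact isClosed_iInter fun p => isClosed_le (by fun_prop) continuous_const
  · intro x hx y hy a b ha hb hab p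
    rw [inner_add_right, inner_smul_right, inner_smul_right]
    calc a * inner ℝ p x + b * inner ℝ p y ≤ a * g p + b * g p := by
          gcongr
          · exact hx p
          · exact hy p
      _ = g p := by rw [← add_mul, hab, one_mul]
  · refine ⟨?_, fun b hb => ?_⟩
    · rintro _ ⟨q, hq, rfl⟩
      exact hq p
    suffices h : ∃ q : EuclideanSpace ℝ (Fin d), (∀ r, inner ℝ r q ≤ g r) ∧ inner ℝ p q = g p by
      obtain ⟨q, hq, hqp⟩ := h
      rw [← hqp]
      exact hb ⟨q, hq, rfl⟩
    -- Hahn–Banach: extend `c • p ↦ c * g p` from the line through `p`, or the zero functional when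
    -- `p = 0`. For `c ≤ 0` domination on the line amounts to `0 ≤ g p + g (-p)`.
    have hex : ∃ l : EuclideanSpace ℝ (Fin d) →ₗ[ℝ] ℝ, l p = g p ∧ ∀ r, l r ≤ g r := by
      by_cases hp : p = 0
      · obtain ⟨l, -, hl⟩ := exists_extension_of_le_sublinear
          (⟨⊥, 0⟩ : EuclideanSpace ℝ (Fin d) →ₗ.[ℝ] ℝ) g (fun c hc x => hhom x c hc.le) hadd
          (by rintro ⟨x, hx⟩
              rw [Submodule.mem_bot] at hx
              subst hx
              exact g0.ge)
        exact ⟨l, by rw [hp, map_zero, g0], hl⟩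
      · obtain ⟨l, hl1, hl⟩ := exists_extension_of_le_sublinear
          (LinearPMap.mkSpanSingleton p (g p) hp) g (fun c hc x => hhom x c hc.le) hadd
          (by rintro ⟨x, hx⟩
              obtain ⟨c, rfl⟩ := Submodule.mem_span_singleton.1 hx
              refine (LinearPMap.mkSpanSingleton'_apply p (g p) _ c hx).trans_le ?_
              rcases le_total 0 c with hc | hc
              · exact (hhom p c hc).ge
              · have h1 := hhom (-p) (-c) (by linarith)
                rw [neg_smul_neg] at h1
                change c * g p ≤ g (c • p)
                rw [h1]
                nlinarith [hneg p])
        refine ⟨l, ?_, hl⟩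
        exact (hl1 ⟨p, Submodule.mem_span_singleton_self p⟩).trans
          (LinearPMap.mkSpanSingleton_apply ℝ ℝ hp (g p))
    obtain ⟨l, hlp, hl⟩ := hex
    refine ⟨(InnerProductSpace.toDual ℝ _).symm (LinearMap.toContinuousLinearMap l), ?_, ?_⟩
    · intro r
      rw [real_inner_comm, InnerProductSpace.toDual_symm_apply]
      exact hl r
    · rw [real_inner_comm, InnerProductSpace.toDual_symm_apply]
      exact hlp

/-! ### Existence of maximal distributions. -/

theorem IsCLLip.continuous {F : Type*} [NormedAddCommGroup F] {f : F → ℝ} (hf : IsCLLip f) :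
    Continuous f := by
  obtain ⟨C, -, m, h⟩ := hf
  rw [continuous_iff_continuousAt]
  intro x
  rw [ContinuousAt, tendsto_iff_norm_sub_tendsto_zero]
  have hc : Tendsto (fun y => C * (1 + ‖y‖ ^ m + ‖x‖ ^ m) * ‖y - x‖) (𝓝 x) (𝓝 0) := by
    have : Continuous fun y => C * (1 + ‖y‖ ^ m + ‖x‖ ^ m) * ‖y - x‖ := by fun_prop
    simpa using this.tendsto x
  exact squeeze_zero (fun _ => norm_nonneg _) (fun y => h y x) hc

/-- The continuous functions on a nonempty compact space with the supremum as expectation. -/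
noncomputable def SublinearExpectationSpace.ofCompact (T : Type*) [TopologicalSpace T]
    [CompactSpace T] [Nonempty T] : SublinearExpectationSpace T where
  H :=
    { carrier := {X | Continuous X}
      add_mem' := fun hX hY => Continuous.add hX hY
      zero_mem' := continuous_const
      smul_mem' := fun c _ hX => Continuous.const_smul hX c }
  const_mem _ := continuous_const
  abs_mem _ hX := Continuous.abs hX
  comp_mem _ _ hX _ hφ := hφ.continuous.comp
    ((PiLp.continuous_toLp 2 _).comp (continuous_pi hX))
  E X := ⨆ t, X t
  mono _ hX _ _ h := ciSup_mono (isCompact_range hX).bddAbove h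
  const _ := ciSup_const
  subadd _ hX _ hY := ciSup_le fun t =>
    add_le_add (le_ciSup (isCompact_range hX).bddAbove t) (le_ciSup (isCompact_range hY).bddAbove t)
  pos_homog _ _ _ hc := (Real.mul_iSup_of_nonneg hc _).symm

/-- The model is `Γ` itself with the supremum as expectation and the inclusion as `η`; compactness
makes the supremum a maximum. -/
theorem exists_isMaximalDistributed {d : ℕ} {Γ : Set (EuclideanSpace ℝ (Fin d))}
    (hb : Bornology.IsBounded Γ) (hc : IsClosed Γ) (hconv : Convex ℝ Γ) (hne : Γ.Nonempty) :
    ∃ (Ω' : Type) (S' : SublinearExpectationSpace Ω') (η : Ω' → EuclideanSpace ℝ (Fin d)),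
      S'.IsMaximalDistributed η Γ := by
  have := hne.to_subtype
  have : CompactSpace Γ := isCompact_iff_compactSpace.1 (Metric.isCompact_of_isClosed_isBounded hc hb)
  refine ⟨Γ, .ofCompact Γ, Subtype.val, fun j => ?_, hb, hc, hconv, fun φ hφ => ?_⟩
  · change Continuous fun ω : Γ => (ω : EuclideanSpace ℝ (Fin d)) j
    fun_prop
  · have hcont : Continuous fun ω : Γ => φ ω := hφ.isCLLip.continuous.comp continuous_subtype_val
    have hK := isCompact_range hcont
    have h : IsGreatest (Set.range fun ω : Γ => φ ω) (⨆ ω : Γ, φ ω) :=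
      hK.isGreatest_sSup (Set.range_nonempty _)
    rwa [Set.image_eq_range]

/-! ### Moment bounds and one-step estimates. -/

namespace SublinearExpectationSpace

variable {Ω : Type*} (S : SublinearExpectationSpace Ω) {d : ℕ}

theorem isCLLip_norm {F : Type*} [NormedAddCommGroup F] : IsCLLip (fun x : F => ‖x‖) :=
  .of_lipschitz (K := 1) fun x y => by rw [one_mul]; exact abs_norm_sub_norm_le x y

theorem isCLLip_inner (p : EuclideanSpace ℝ (Fin d)) :
    IsCLLip (fun x : EuclideanSpace ℝ (Fin d) => inner ℝ x p) :=
  .of_lipschitz (K := ‖p‖) fun x y => by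
    rw [← inner_sub_left, mul_comm]; exact abs_real_inner_le_norm _ _

section Moments

variable {S} {X : Ω → EuclideanSpace ℝ (Fin d)} {M : ℝ}

theorem IsRandomVector.inner_mem (hX : S.IsRandomVector X) (p : EuclideanSpace ℝ (Fin d)) :
    (fun ω => inner ℝ (X ω) p) ∈ S.H := hX.comp_mem (isCLLip_inner p)

theorem IsRandomVector.E_norm_le (hX : S.IsRandomVector X) (hM : S.E (fun ω => ‖X ω‖ ^ 2) ≤ M) :
    S.E (fun ω => ‖X ω‖) ≤ 1 + M := by
  have h2 := hX.comp_mem (isCLLip_norm_pow 2)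
  have h := S.mono _ (S.add_mem h2 (S.const_mem 1)) _ (hX.comp_mem isCLLip_norm) fun ω => by
    nlinarith [sq_nonneg (‖X ω‖ - 1), sq_nonneg ‖X ω‖]
  linarith [S.E_add_const_le h2 1]

theorem IsRandomVector.E_inner_add_le (hX : S.IsRandomVector X)
    (p q : EuclideanSpace ℝ (Fin d)) :
    S.E (fun ω => inner ℝ (X ω) (p + q)) ≤
      S.E (fun ω => inner ℝ (X ω) p) + S.E (fun ω => inner ℝ (X ω) q) := by
  simpa only [inner_add_right] using S.subadd _ (hX.inner_mem p) _ (hX.inner_mem q)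

theorem IsRandomVector.E_inner_smul (hX : S.IsRandomVector X)
    (p : EuclideanSpace ℝ (Fin d)) {c : ℝ} (hc : 0 ≤ c) :
    S.E (fun ω => inner ℝ (X ω) (c • p)) = c * S.E (fun ω => inner ℝ (X ω) p) := by
  simpa only [inner_smul_right] using S.pos_homog _ (hX.inner_mem p) c hc

/-- The Lipschitz constant depends only on `M`, so it serves all `Y i` at once; this is what
upgrades pointwise convergence of the `g_i` to uniform convergence on the unit ball. -/
theorem IsRandomVector.abs_E_inner_sub_le (hX : S.IsRandomVector X)
    (hM : S.E (fun ω => ‖X ω‖ ^ 2) ≤ M) (p q : EuclideanSpace ℝ (Fin d)) :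
    |S.E (fun ω => inner ℝ (X ω) p) - S.E (fun ω => inner ℝ (X ω) q)| ≤ (1 + M) * ‖p - q‖ := by
  have hN := hX.comp_mem isCLLip_norm
  refine (S.abs_E_sub_E_le (hX.inner_mem p) (hX.inner_mem q) (S.smul_mem hN ‖p - q‖)
    fun ω => ?_).trans ?_
  · rw [← inner_sub_right, mul_comm]
    exact abs_real_inner_le_norm _ _
  · rw [S.pos_homog _ hN _ (norm_nonneg _), mul_comm]
    gcongr
    exact hX.E_norm_le hM

theorem IsRandomVector.E_norm_sub_sq_le (hX : S.IsRandomVector X)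
    (hM : S.E (fun ω => ‖X ω‖ ^ 2) ≤ M) {q : EuclideanSpace ℝ (Fin d)} {R : ℝ} (hq : ‖q‖ ≤ R) :
    S.E (fun ω => ‖X ω - q‖ ^ 2) ≤ 2 * M + 2 * R ^ 2 := by
  have h2 := hX.comp_mem (isCLLip_norm_pow 2)
  have hR : ‖q‖ ^ 2 ≤ R ^ 2 := pow_le_pow_left₀ (norm_nonneg q) hq 2
  have hXq : S.IsRandomVector fun ω => X ω - q := by
    simpa only [sub_eq_add_neg] using hX.add (S.isRandomVector_const (-q))
  have h := S.mono _ (S.add_mem (S.smul_mem h2 2) (S.const_mem (2 * R ^ 2))) _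
    (hXq.comp_mem (isCLLip_norm_pow 2)) fun ω => by
      have := norm_sub_le (X ω) q
      have h1 : ‖X ω - q‖ ^ 2 ≤ (‖X ω‖ + ‖q‖) ^ 2 := pow_le_pow_left₀ (norm_nonneg _) this 2
      nlinarith [sq_nonneg (‖X ω‖ - ‖q‖)]
  have h' := S.E_add_const_le (S.smul_mem h2 2) (2 * R ^ 2)
  rw [S.pos_homog _ h2 2 (by norm_num)] at h'
  linarith

/-- One step of the upper estimate. -/
theorem IsRandomVector.E_norm_add_sub_sq_le (hX : S.IsRandomVector X)
    (hM : S.E (fun ω => ‖X ω‖ ^ 2) ≤ M) {q : EuclideanSpace ℝ (Fin d)} {R : ℝ} (hq : ‖q‖ ≤ R)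
    (a : EuclideanSpace ℝ (Fin d)) :
    S.E (fun ω => ‖a + X ω - q‖ ^ 2) ≤
      ‖a‖ ^ 2 + 2 * (S.E (fun ω => inner ℝ (X ω) a) - inner ℝ a q) + (2 * M + 2 * R ^ 2) := by
  have hXq : S.IsRandomVector fun ω => X ω - q := by
    simpa only [sub_eq_add_neg] using hX.add (S.isRandomVector_const (-q))
  have hQ := hXq.comp_mem (isCLLip_norm_pow 2)
  have hI := S.smul_mem (hX.inner_mem a) 2
  have e : (fun ω => ‖a + X ω - q‖ ^ 2) = fun ω =>
      (2 * inner ℝ (X ω) a + ‖X ω - q‖ ^ 2) + (‖a‖ ^ 2 - 2 * inner ℝ a q) := by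
    funext ω
    rw [add_sub_assoc, norm_add_sq_real, inner_sub_right, real_inner_comm]
    ring
  rw [e]
  have h1 := S.E_add_const_le (S.add_mem hI hQ) (‖a‖ ^ 2 - 2 * inner ℝ a q)
  have h2 := S.subadd _ hI _ hQ
  rw [S.pos_homog _ (hX.inner_mem a) 2 (by norm_num)] at h2
  linarith [hX.E_norm_sub_sq_le hM hq]

/-- One step of the lower estimate. -/
theorem IsRandomVector.le_E_neg_norm_add_sub_sq (hX : S.IsRandomVector X)
    (hM : S.E (fun ω => ‖X ω‖ ^ 2) ≤ M) {q : EuclideanSpace ℝ (Fin d)} {R : ℝ} (hq : ‖q‖ ≤ R)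
    (a : EuclideanSpace ℝ (Fin d)) :
    -‖a‖ ^ 2 + 2 * (S.E (fun ω => inner ℝ (X ω) (-a)) - inner ℝ (-a) q) - (2 * M + 2 * R ^ 2) ≤
      S.E (fun ω => -‖a + X ω - q‖ ^ 2) := by
  have hXq : S.IsRandomVector fun ω => X ω - q := by
    simpa only [sub_eq_add_neg] using hX.add (S.isRandomVector_const (-q))
  have hQ := hXq.comp_mem (isCLLip_norm_pow 2)
  have hI := S.smul_mem (hX.inner_mem (-a)) 2
  -- The minus sign goes into `-a`: `E` is only positively homogeneous, so the cross term must carry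
  -- the coefficient `+2`.
  have e : (fun ω => -‖a + X ω - q‖ ^ 2) = fun ω =>
      (2 * inner ℝ (X ω) (-a) - ‖X ω - q‖ ^ 2) + (-‖a‖ ^ 2 - 2 * inner ℝ (-a) q) := by
    funext ω
    rw [add_sub_assoc, norm_add_sq_real, inner_sub_right, real_inner_comm, inner_neg_right,
      inner_neg_left]
    ring
  rw [e]
  have h1 := S.le_E_add_const (S.sub_mem hI hQ) (-‖a‖ ^ 2 - 2 * inner ℝ (-a) q)
  have h2 := S.E_sub_E_le hI hQ
  rw [S.pos_homog _ (hX.inner_mem (-a)) 2 (by norm_num)] at h2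
  linarith [hX.E_norm_sub_sq_le hM hq]

end Moments

/-! ### From one-step estimates to `o(n²)` bounds for partial sums. -/

section PartialSums

variable {Y : ℕ → Ω → EuclideanSpace ℝ (Fin d)} {M : ℝ}

theorem E_norm_sum_le (hY : ∀ i, S.IsRandomVector (Y i))
    (hM : ∀ i, S.E (fun ω => ‖Y i ω‖ ^ 2) ≤ M) (n : ℕ) :
    S.E (fun ω => ‖∑ i ∈ Finset.range n, Y i ω‖) ≤ n * (1 + M) := by
  induction n with
  | zero => simpa using (S.const 0).le
  | succ n ih =>
    have hS := (IsRandomVector.sum hY n).comp_mem isCLLip_norm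
    have hN := (hY n).comp_mem isCLLip_norm
    have h1 := S.mono _ (S.add_mem hS hN) _
      ((IsRandomVector.sum hY (n + 1)).comp_mem isCLLip_norm) fun ω => by
        rw [Finset.sum_range_succ]; exact norm_add_le _ _
    have h2 := S.subadd _ hS _ hN
    have h3 := (hY n).E_norm_le (hM n)
    push_cast
    linarith

variable {h : ℕ → EuclideanSpace ℝ (Fin d) → ℝ} {R C : ℝ}

theorem E_le_of_le_norm_add (hY : ∀ i, S.IsRandomVector (Y i))
    (hM : ∀ i, S.E (fun ω => ‖Y i ω‖ ^ 2) ≤ M)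
    (hlip : ∀ n x y, |h n x - h n y| ≤ ‖x - y‖) (hR : ∀ n x, h n x ≤ ‖x‖ + n * R) (n : ℕ) :
    S.E (fun ω => h n (∑ i ∈ Finset.range n, Y i ω)) ≤ n * (1 + M + R) := by
  have hS := (IsRandomVector.sum hY n).comp_mem isCLLip_norm
  have h1 := S.mono _ (S.add_mem hS (S.const_mem (n * R))) _
    ((IsRandomVector.sum hY n).comp_mem
      (.of_lipschitz (K := 1) fun x y => by rw [one_mul]; exact hlip n x y)) fun ω => hR n _
  have h2 := S.E_add_const_le hS (n * R)
  have h3 := S.E_norm_sum_le hY hM n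
  linarith

/-- Conditioning on the partial sum turns `hstep` into a recursion for `E (h n S_n)²`. Linear growth
of `E (h n S_n)` makes the term `ε * h` cost `O(ε n)`, so the increments sum to `o(n²)`. -/
theorem eventually_E_sq_le (hY : ∀ i, S.IsRandomVector (Y i))
    (hindep : ∀ i : ℕ, S.IndependentFrom (Y (i + 1))
      (fun ω => fun k : Fin (i + 1) => Y (k : ℕ) ω))
    (hM0 : 0 ≤ M) (hM : ∀ i, S.E (fun ω => ‖Y i ω‖ ^ 2) ≤ M)
    (h0 : ∀ n x, 0 ≤ h n x) (hlip : ∀ n x y, |h n x - h n y| ≤ ‖x - y‖)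
    (hR0 : 0 ≤ R) (hR : ∀ n x, h n x ≤ ‖x‖ + n * R)
    (hstep : ∀ ε > 0, ∀ᶠ n in atTop, ∀ x,
      S.E (fun ω => h (n + 1) (x + Y n ω) ^ 2) ≤ h n x ^ 2 + ε * h n x + C)
    {ε : ℝ} (hε : 0 < ε) :
    ∀ᶠ n : ℕ in atTop,
      S.E (fun ω => h n (∑ i ∈ Finset.range n, Y i ω) ^ 2) ≤ ε * (n : ℝ) ^ 2 := by
  refine eventually_le_mul_sq_of_increments (C := C) (fun δ hδ => ?_) hε
  have hK : 0 < 1 + M + R := by positivity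
  -- `1 + M + R` is the linear growth rate of `E (h n S_n)`; dividing by it leaves exactly `δ * n`.
  filter_upwards [hstep (δ / (1 + M + R)) (by positivity), eventually_ge_atTop 1] with n hn hn1
  have hsq : ∀ n, IsCLLip (fun x => h n x ^ 2) := fun n => .sq_of_lipschitz (h0 n) (hlip n)
  have hSn := IsRandomVector.sum hY n
  have h1mem := hSn.comp_mem
    (.of_lipschitz (K := 1) fun x y => by rw [one_mul]; exact hlip n x y)
  have h2mem := hSn.comp_mem (hsq n)
  rw [S.E_sum_succ hindep (hsq (n + 1)) hn1]
  set c := δ / (1 + M + R)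
  have hc : 0 ≤ c := by positivity
  have ha := S.mono _ (S.add_mem (S.add_mem h2mem (S.smul_mem h1mem c)) (S.const_mem C)) _
    (hSn.comp_mem ((hY n).isCLLip_E (hsq (n + 1)))) fun ω => hn _
  have hb := S.E_add_const_le (S.add_mem h2mem (S.smul_mem h1mem c)) C
  have hc' := S.subadd _ h2mem _ (S.smul_mem h1mem c)
  rw [S.pos_homog _ h1mem c hc] at hc'
  have hd := mul_le_mul_of_nonneg_left (S.E_le_of_le_norm_add hY hM hlip hR n) hc
  have he : c * (n * (1 + M + R)) = δ * n := by
    simp only [c]; field_simp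
  linarith

/-- The same recursion for the lower expectation `-E[-h²]`. Its `hstep` is weaker than in
`eventually_E_sq_le`, since `-E[-h²] ≤ E[h²]`, and so is its conclusion. -/
theorem eventually_le_E_neg_sq (hY : ∀ i, S.IsRandomVector (Y i))
    (hindep : ∀ i : ℕ, S.IndependentFrom (Y (i + 1))
      (fun ω => fun k : Fin (i + 1) => Y (k : ℕ) ω))
    (hM0 : 0 ≤ M) (hM : ∀ i, S.E (fun ω => ‖Y i ω‖ ^ 2) ≤ M)
    (h0 : ∀ n x, 0 ≤ h n x) (hlip : ∀ n x y, |h n x - h n y| ≤ ‖x - y‖)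
    (hR0 : 0 ≤ R) (hR : ∀ n x, h n x ≤ ‖x‖ + n * R)
    (hstep : ∀ ε > 0, ∀ᶠ n in atTop, ∀ x,
      -(h n x ^ 2 + ε * h n x + C) ≤ S.E (fun ω => -h (n + 1) (x + Y n ω) ^ 2))
    {ε : ℝ} (hε : 0 < ε) :
    ∀ᶠ n : ℕ in atTop,
      -(ε * (n : ℝ) ^ 2) ≤ S.E (fun ω => -h n (∑ i ∈ Finset.range n, Y i ω) ^ 2) := by
  suffices hs : ∀ᶠ n : ℕ in atTop,
      -S.E (fun ω => -h n (∑ i ∈ Finset.range n, Y i ω) ^ 2) ≤ ε * (n : ℝ) ^ 2 from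
    hs.mono fun n hn => by linarith
  refine eventually_le_mul_sq_of_increments (C := C) (fun δ hδ => ?_) hε
  have hK : 0 < 1 + M + R := by positivity
  filter_upwards [hstep (δ / (1 + M + R)) (by positivity), eventually_ge_atTop 1] with n hn hn1
  have hsq : ∀ n, IsCLLip (fun x => -h n x ^ 2) := fun n =>
    (IsCLLip.sq_of_lipschitz (h0 n) (hlip n)).neg
  have hSn := IsRandomVector.sum hY n
  have h1mem := hSn.comp_mem
    (.of_lipschitz (K := 1) fun x y => by rw [one_mul]; exact hlip n x y)
  have h2mem := hSn.comp_mem (hsq n)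
  rw [S.E_sum_succ hindep (hsq (n + 1)) hn1]
  set c := δ / (1 + M + R)
  have hc : 0 ≤ c := by positivity
  have hdiff := S.sub_mem h2mem (S.smul_mem h1mem c)
  have ha := S.mono _ (hSn.comp_mem ((hY n).isCLLip_E (hsq (n + 1)))) _
    (S.add_mem hdiff (S.const_mem (-C))) fun ω => by
      refine le_trans (le_of_eq ?_) (hn _)
      ring
  have hb := S.le_E_add_const hdiff (-C)
  have hc' := S.E_sub_E_le h2mem (S.smul_mem h1mem c)
  rw [S.pos_homog _ h1mem c hc] at hc'
  have hd := mul_le_mul_of_nonneg_left (S.E_le_of_le_norm_add hY hM hlip hR n) hc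
  have he : c * (n * (1 + M + R)) = δ * n := by
    simp only [c]; field_simp
  linarith

end PartialSums

end SublinearExpectationSpace

/-! ### The law of large numbers. -/

section LawOfLargeNumbers

open scoped Pointwise

theorem abs_infDist_sub_infDist_le {F : Type*} [NormedAddCommGroup F] (s : Set F) (x y : F) :
    |Metric.infDist x s - Metric.infDist y s| ≤ ‖x - y‖ := by
  simpa [Real.dist_eq, dist_eq_norm] using (Metric.lipschitz_infDist_pt s).dist_le_mul x y

/-- Adding a point `q` of `Γ` to the projection of `x` to `n Γ` gives a point of `(n + 1) Γ`. -/
theorem exists_norm_eq_infDist_smul {d : ℕ} {Γ : Set (EuclideanSpace ℝ (Fin d))}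
    (hΓ : IsCompact Γ) (hconv : Convex ℝ Γ) (hne : Γ.Nonempty) (n : ℕ)
    (x : EuclideanSpace ℝ (Fin d)) :
    ∃ a, ‖a‖ = Metric.infDist x ((n : ℝ) • Γ) ∧ ∀ y, ∀ q ∈ Γ,
      Metric.infDist (x + y) (((n + 1 : ℕ) : ℝ) • Γ) ≤ ‖a + y - q‖ := by
  obtain ⟨p, hp, hpd⟩ := (hΓ.smul (n : ℝ)).exists_infDist_eq_dist hne.smul_set x
  refine ⟨x - p, by rw [hpd, dist_eq_norm], fun y q hq => ?_⟩
  have hmem : p + q ∈ ((n + 1 : ℕ) : ℝ) • Γ := by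
    push_cast
    -- Convexity enters here: `(n + 1) Γ = n Γ + Γ`.
    rw [hconv.add_smul n.cast_nonneg zero_le_one, one_smul]
    exact Set.add_mem_add hp hq
  refine (Metric.infDist_le_dist_of_mem hmem).trans_eq ?_
  rw [dist_eq_norm]
  congr 1
  abel

namespace SublinearExpectationSpace

variable {Ω : Type*} (S : SublinearExpectationSpace Ω) {d : ℕ}
  {Y : ℕ → Ω → EuclideanSpace ℝ (Fin d)} {M : ℝ} {g : EuclideanSpace ℝ (Fin d) → ℝ}
  {Γ : Set (EuclideanSpace ℝ (Fin d))}

theorem exists_represents_of_tendsto (hY : ∀ i, S.IsRandomVector (Y i))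
    (hmoment : ∀ i, S.E (fun ω => ‖Y i ω‖ ^ 2) ≤ M)
    (hg : ∀ p, Tendsto (fun i => S.E (fun ω => inner ℝ (Y i ω) p)) atTop (𝓝 (g p))) :
    ∃ Γ : Set (EuclideanSpace ℝ (Fin d)), Represents Γ g := by
  refine exists_represents (K := 1 + M) (fun p => ?_) (fun p q => ?_) fun p c hc => ?_
  · refine le_of_tendsto (hg p) (Eventually.of_forall fun i => ?_)
    have h := (le_abs_self _).trans ((hY i).abs_E_inner_sub_le (hmoment i) p 0)
    simpa [S.const] using h
  · exact le_of_tendsto_of_tendsto (hg (p + q)) ((hg p).add (hg q))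
      (Eventually.of_forall fun i => (hY i).E_inner_add_le p q)
  · exact tendsto_nhds_unique (hg (c • p))
      (((hg p).const_mul c).congr fun i => ((hY i).E_inner_smul p hc).symm)

theorem eventually_abs_E_inner_sub_le (hY : ∀ i, S.IsRandomVector (Y i)) (hM : 0 ≤ M)
    (hmoment : ∀ i, S.E (fun ω => ‖Y i ω‖ ^ 2) ≤ M)
    (hg : ∀ p, Tendsto (fun i => S.E (fun ω => inner ℝ (Y i ω) p)) atTop (𝓝 (g p)))
    {ε : ℝ} (hε : 0 < ε) :
    ∀ᶠ i in atTop, ∀ p, |S.E (fun ω => inner ℝ (Y i ω) p) - g p| ≤ ε * ‖p‖ :=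
  eventually_abs_sub_le_mul_norm (K := 1 + M) (by linarith)
    (fun i => (hY i).abs_E_inner_sub_le (hmoment i)) (fun i p _ hc => (hY i).E_inner_smul p hc)
    hg hε

theorem eventually_E_infDist_sq_le (hY : ∀ i, S.IsRandomVector (Y i))
    (hindep : ∀ i : ℕ, S.IndependentFrom (Y (i + 1))
      (fun ω => fun k : Fin (i + 1) => Y (k : ℕ) ω))
    (hM : 0 ≤ M) (hmoment : ∀ i, S.E (fun ω => ‖Y i ω‖ ^ 2) ≤ M)
    (hg : ∀ p, Tendsto (fun i => S.E (fun ω => inner ℝ (Y i ω) p)) atTop (𝓝 (g p)))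
    (hΓ : IsCompact Γ) (hconv : Convex ℝ Γ) (hne : Γ.Nonempty)
    (hlub : ∀ p, IsLUB ((fun q => inner ℝ p q) '' Γ) (g p)) {ε : ℝ} (hε : 0 < ε) :
    ∀ᶠ n : ℕ in atTop,
      S.E (fun ω => Metric.infDist (∑ i ∈ Finset.range n, Y i ω) ((n : ℝ) • Γ) ^ 2) ≤
        ε * (n : ℝ) ^ 2 := by
  obtain ⟨R, hR⟩ := hΓ.isBounded.exists_norm_le
  obtain ⟨q₀, hq₀⟩ := hne
  have hR0 : 0 ≤ R := (norm_nonneg _).trans (hR q₀ hq₀)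
  refine S.eventually_E_sq_le (h := fun n x => Metric.infDist x ((n : ℝ) • Γ)) (R := R)
    (C := 2 * M + 2 * R ^ 2) hY hindep hM hmoment (fun _ _ => Metric.infDist_nonneg)
    (fun n => abs_infDist_sub_infDist_le _) hR0 (fun n x => ?_) (fun δ hδ => ?_) hε
  · have h := Metric.infDist_le_dist_of_mem (x := x) (Set.smul_mem_smul_set (a := (n : ℝ)) hq₀)
    rw [dist_eq_norm] at h
    refine h.trans ((norm_sub_le _ _).trans ?_)
    rw [norm_smul, Real.norm_natCast]
    gcongr
    exact hR q₀ hq₀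
  -- `δ / 2` because the cross term of the square is doubled.
  · filter_upwards [S.eventually_abs_E_inner_sub_le hY hM hmoment hg
      (show 0 < δ / 2 by positivity)] with n hn x
    obtain ⟨a, ha, hstep⟩ := exists_norm_eq_infDist_smul hΓ hconv ⟨q₀, hq₀⟩ n x
    -- This `q` attains `g a`, so the drift reduces to `g_n a - g a`. It may depend on `x`, which is
    -- frozen in the one-step estimate.
    obtain ⟨q, hq, hqmax⟩ := hΓ.exists_isMaxOn ⟨q₀, hq₀⟩
      (f := fun q => inner ℝ a q) (by fun_prop)
    have hga : g a ≤ inner ℝ a q := (hlub a).2 (by rintro _ ⟨r, hr, rfl⟩; exact hqmax hr)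
    have hXq : S.IsRandomVector fun ω => a + Y n ω - q := by
      simpa only [sub_eq_add_neg] using
        ((S.isRandomVector_const a).add (hY n)).add (S.isRandomVector_const (-q))
    have h1 := S.mono _ (hXq.comp_mem (isCLLip_norm_pow 2)) _
      (((S.isRandomVector_const x).add (hY n)).comp_mem
        (.sq_of_lipschitz (fun _ => Metric.infDist_nonneg)
          (abs_infDist_sub_infDist_le (((n + 1 : ℕ) : ℝ) • Γ)))) fun ω =>
        pow_le_pow_left₀ Metric.infDist_nonneg (hstep (Y n ω) q hq) 2
    have h2 := (hY n).E_norm_add_sub_sq_le (hmoment n) (hR q hq) a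
    have h3 := (abs_le.1 (hn a)).2
    rw [← ha]
    linarith

/-- With `a = x - n q`, the cross term is `2 (g_n (-a) - ⟨-a, q⟩)`. It is nearly nonnegative because
`⟨-a, q⟩ ≤ g (-a)`, so one fixed `q` works at every step. -/
theorem eventually_le_E_neg_norm_sub_sq (hY : ∀ i, S.IsRandomVector (Y i))
    (hindep : ∀ i : ℕ, S.IndependentFrom (Y (i + 1))
      (fun ω => fun k : Fin (i + 1) => Y (k : ℕ) ω))
    (hM : 0 ≤ M) (hmoment : ∀ i, S.E (fun ω => ‖Y i ω‖ ^ 2) ≤ M)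
    (hg : ∀ p, Tendsto (fun i => S.E (fun ω => inner ℝ (Y i ω) p)) atTop (𝓝 (g p)))
    {q : EuclideanSpace ℝ (Fin d)} (hq : ∀ p, inner ℝ p q ≤ g p) {ε : ℝ} (hε : 0 < ε) :
    ∀ᶠ n : ℕ in atTop, -(ε * (n : ℝ) ^ 2) ≤
      S.E (fun ω => -‖∑ i ∈ Finset.range n, Y i ω - (n : ℝ) • q‖ ^ 2) := by
  refine S.eventually_le_E_neg_sq (h := fun n x => ‖x - (n : ℝ) • q‖) (R := ‖q‖)
    (C := 2 * M + 2 * ‖q‖ ^ 2) hY hindep hM hmoment (fun _ _ => norm_nonneg _)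
    (fun n x y => ?_) (norm_nonneg _) (fun n x => ?_) (fun δ hδ => ?_) hε
  · simpa using abs_norm_sub_norm_le (x - (n : ℝ) • q) (y - (n : ℝ) • q)
  · refine (norm_sub_le _ _).trans ?_
    rw [norm_smul, Real.norm_natCast]
  · filter_upwards [S.eventually_abs_E_inner_sub_le hY hM hmoment hg
      (show 0 < δ / 2 by positivity)] with n hn x
    have e : ∀ ω, x + Y n ω - ((n + 1 : ℕ) : ℝ) • q = x - (n : ℝ) • q + Y n ω - q := fun ω => by
      push_cast
      rw [add_smul, one_smul]
      abel
    simp only [e]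
    have h2 := (hY n).le_E_neg_norm_add_sub_sq (hmoment n) le_rfl (q := q) (x - (n : ℝ) • q)
    have h3 := (abs_le.1 (hn (-(x - (n : ℝ) • q)))).1
    rw [norm_neg] at h3
    linarith [hq (-(x - (n : ℝ) • q))]

/-- The law of large numbers: the expectations of a bounded Lipschitz function of the means
converge to its maximum over `Γ`. -/
theorem tendsto_E_mean (hY : ∀ i, S.IsRandomVector (Y i))
    (hindep : ∀ i : ℕ, S.IndependentFrom (Y (i + 1))
      (fun ω => fun k : Fin (i + 1) => Y (k : ℕ) ω))
    (hM : 0 ≤ M) (hmoment : ∀ i, S.E (fun ω => ‖Y i ω‖ ^ 2) ≤ M)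
    (hg : ∀ p, Tendsto (fun i => S.E (fun ω => inner ℝ (Y i ω) p)) atTop (𝓝 (g p)))
    (hrep : Represents Γ g) {φ : EuclideanSpace ℝ (Fin d) → ℝ} (hφ : IsCBLip φ) {m : ℝ}
    (hm : IsGreatest (φ '' Γ) m) :
    Tendsto (fun n : ℕ => S.E (fun ω => φ ((n : ℝ)⁻¹ • ∑ i ∈ Finset.range n, Y i ω)))
      atTop (𝓝 m) := by
  obtain ⟨hb, hc, hconv, hlub⟩ := hrep
  have hΓ : IsCompact Γ := Metric.isCompact_of_isClosed_isBounded hc hb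
  obtain ⟨⟨y, hy, hym⟩, hmax⟩ := hm
  have hφ' := hφ.isCLLip
  obtain ⟨⟨L, hL⟩, -⟩ := hφ
  have hL0 : (0 : ℝ) ≤ L := L.coe_nonneg
  -- Young-type bound `t ≤ δ + t² / δ` with `t = ‖s / n - q‖`: it trades the Lipschitz distance for
  -- the squared distance that the estimates control.
  have key : ∀ n : ℕ, 1 ≤ n → ∀ δ : ℝ, 0 < δ → ∀ s q : EuclideanSpace ℝ (Fin d),
      |φ ((n : ℝ)⁻¹ • s) - φ q| ≤ L * δ + L * (δ * (n : ℝ) ^ 2)⁻¹ * ‖s - (n : ℝ) • q‖ ^ 2 := by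
    intro n hn δ hδ s q
    have hn0 : (0 : ℝ) < n := by exact_mod_cast hn
    have h1 := hL.dist_le_mul ((n : ℝ)⁻¹ • s) q
    rw [Real.dist_eq, dist_eq_norm] at h1
    have h2 : (n : ℝ)⁻¹ • s - q = (n : ℝ)⁻¹ • (s - (n : ℝ) • q) := by
      rw [smul_sub, inv_smul_smul₀ hn0.ne']
    rw [h2, norm_smul, norm_inv, Real.norm_natCast] at h1
    refine h1.trans ?_
    rw [mul_assoc, ← mul_add]
    gcongr
    set t := (n : ℝ)⁻¹ * ‖s - (n : ℝ) • q‖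
    have h3 : (δ * (n : ℝ) ^ 2)⁻¹ * ‖s - (n : ℝ) • q‖ ^ 2 = t ^ 2 / δ := by
      simp only [t]; field_simp
    rw [h3, ← sub_nonneg]
    have h4 : δ + t ^ 2 / δ - t = ((t - δ / 2) ^ 2 + 3 / 4 * δ ^ 2) / δ := by field_simp; ring
    rw [h4]
    positivity
  have hmean : ∀ n : ℕ, S.IsRandomVector
      (fun ω => (n : ℝ)⁻¹ • ∑ i ∈ Finset.range n, Y i ω) := fun n j =>
    S.smul_mem (IsRandomVector.sum hY n j) _
  rw [Metric.tendsto_nhds]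
  intro ε hε
  obtain ⟨δ, hδ, hδε⟩ : ∃ δ > 0, 2 * (L * δ) < ε := by
    refine ⟨ε / (2 * (L + 1)), by positivity, ?_⟩
    rw [← mul_assoc, mul_div_assoc', div_lt_iff₀ (by positivity)]
    nlinarith
  have hδ2 : 0 < δ ^ 2 := by positivity
  -- With tolerance `δ ^ 2` the quadratic term also contributes `L * δ`, for a total error `2 * (L *
  -- δ) < ε`. The lower estimate is used at the maximizer `y` of `φ`.
  filter_upwards [S.eventually_E_infDist_sq_le hY hindep hM hmoment hg hΓ hconv ⟨y, hy⟩ hlub hδ2,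
    S.eventually_le_E_neg_norm_sub_sq hY hindep hM hmoment hg
      (fun p => (hlub p).1 ⟨y, hy, rfl⟩) hδ2, eventually_ge_atTop 1] with n hup hlow hn
  have hn0 : (0 : ℝ) < n := by exact_mod_cast hn
  have hSn := IsRandomVector.sum hY n
  set c : ℝ := L * (δ * n ^ 2)⁻¹
  have hc0 : 0 ≤ c := by positivity
  have hcδ : c * (δ ^ 2 * n ^ 2) = L * δ := by simp only [c]; field_simp
  have hφmem := (hmean n).comp_mem hφ'
  rw [Real.dist_eq, abs_lt]
  constructor
  · have hQ := hSn.comp_mem (f := fun s => -‖s - (n : ℝ) • y‖ ^ 2)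
      (IsCLLip.sq_of_lipschitz (fun _ => norm_nonneg _) fun x z => by
        simpa using abs_norm_sub_norm_le (x - (n : ℝ) • y) (z - (n : ℝ) • y)).neg
    have h1 := S.mono _ hφmem _ (S.add_mem (S.smul_mem hQ c) (S.const_mem (m - L * δ)))
      fun ω => by
        have := (abs_le.1 (key n hn δ hδ (∑ i ∈ Finset.range n, Y i ω) y)).1
        simp only [hym] at this ⊢
        linarith
    have h2 := S.le_E_add_const (S.smul_mem hQ c) (m - L * δ)
    rw [S.pos_homog _ hQ c hc0] at h2
    have h3 := mul_le_mul_of_nonneg_left hlow hc0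
    linarith
  · have hQ := hSn.comp_mem (f := fun s => Metric.infDist s ((n : ℝ) • Γ) ^ 2)
      (.sq_of_lipschitz (fun _ => Metric.infDist_nonneg) (abs_infDist_sub_infDist_le _))
    have h1 := S.mono _ (S.add_mem (S.smul_mem hQ c) (S.const_mem (m + L * δ))) _ hφmem
      fun ω => by
        -- The comparison point varies with `ω`: `n q` is a nearest point of `n Γ` to the sum, and
        -- `φ q ≤ m` wherever `q` lies in `Γ`.
        obtain ⟨_, ⟨q, hq, rfl⟩, hd⟩ := (hΓ.smul (n : ℝ)).exists_infDist_eq_dist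
          (Set.Nonempty.smul_set ⟨y, hy⟩) (∑ i ∈ Finset.range n, Y i ω)
        have h4 := (abs_le.1 (key n hn δ hδ (∑ i ∈ Finset.range n, Y i ω) q)).2
        have h5 : φ q ≤ m := hmax ⟨q, hq, rfl⟩
        rw [hd, dist_eq_norm]
        linarith
    have h2 := S.E_add_const_le (S.smul_mem hQ c) (m + L * δ)
    rw [S.pos_homog _ hQ c hc0] at h2
    have h3 := mul_le_mul_of_nonneg_left hup hc0
    linarith

end SublinearExpectationSpace

end LawOfLargeNumbers

theorem corollary5p5 {Ω : Type*} (S : SublinearExpectationSpace Ω) (d : ℕ)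
    (Y : ℕ → Ω → EuclideanSpace ℝ (Fin d))
    (hY : ∀ i, S.IsRandomVector (Y i))
    (hindep : ∀ i : ℕ, S.IndependentFrom (Y (i + 1))
      (fun ω => fun k : Fin (i + 1) => Y (k : ℕ) ω))
    (M : ℝ) (hM : 0 < M) (hmoment : ∀ i, S.E (fun ω => ‖Y i ω‖ ^ 2) ≤ M)
    (g : EuclideanSpace ℝ (Fin d) → ℝ)
    (hg : ∀ p, Tendsto (fun i => S.E (fun ω => inner ℝ (Y i ω) p)) atTop (𝓝 (g p))) :
    (∃ Γ : Set (EuclideanSpace ℝ (Fin d)), Represents Γ g) ∧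
    ∀ Γ : Set (EuclideanSpace ℝ (Fin d)), Represents Γ g →
      (∃ (Ω' : Type) (S' : SublinearExpectationSpace Ω') (η : Ω' → EuclideanSpace ℝ (Fin d)),
        S'.IsMaximalDistributed η Γ) ∧
      ∀ (Ω' : Type*) (S' : SublinearExpectationSpace Ω') (η : Ω' → EuclideanSpace ℝ (Fin d)),
        S'.IsMaximalDistributed η Γ →
        ∀ φ : EuclideanSpace ℝ (Fin d) → ℝ, IsCBLip φ →
          Tendsto
            (fun n : ℕ => S.E (fun ω => φ ((n : ℝ)⁻¹ • ∑ i ∈ Finset.range n, Y i ω)))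
            atTop (𝓝 (S'.E (fun ω' => φ (η ω')))) := by

  refine ⟨S.exists_represents_of_tendsto hY hmoment hg, fun Γ hrep => ⟨?_, ?_⟩⟩
  -- `Γ` is nonempty because the empty set has no least upper bound in `ℝ`; `p = 0` is an arbitrary
  -- choice.
  · exact exists_isMaximalDistributed hrep.1 hrep.2.1 hrep.2.2.1
      (Set.image_nonempty.1 (hrep.2.2.2 0).nonempty)
  · intro Ω' S' η hη φ hφ
    exact S.tendsto_E_mean hY hindep hM.le hmoment hg hrep hφ (hη.2.2.2.2 φ hφ)
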